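/- Let $n\ge 1$ and let $\mathbf B$ be a constant real $n\times n$ matrix. Let $\mathbb S_0^{n\times n}$ be the space of symmetric trace-free real $n\times n$ matrices, equip $\mathbb R^n\times\mathbb S_0^{n\times n}$ with the Euclidean norm $|(m,\mathbf U)|^2=|m|^2+\sum_{i,j}\mathbf U_{ij}^2$, and let $$\Lambda=\{(\bar m,\bar{\mathbf U})\in\mathbb R^n\times\mathbb S_0^{n\times n}:\ \text{there is } \eta\in\mathbb R^n\setminus\{0\}\text{ with }\bar m\cdot\eta=0\text{ and }\bar{\mathbf U}\eta=0\}.$$ Suppose that $w,w_1,w_2\in\mathbb R^n\times\mathbb S_0^{n\times n}$ and $\mu_1,\mu_2\ge 0$ satisfy $$w=\mu_1w_1+\mu_2w_2,\qquad \mu_1+\mu_2=1,\qquad w_2-w_1\in\Lambda.$$ Then for every open set $\mathcal O\subset\mathbb R^n$ of finite Lebesgue measure and every $\varepsilon>0$ there exists $\tilde w=(\tilde n,\tilde{\mathbf V})\in C_c^\infty(\mathcal O;\mathbb R^n\times\mathbb S_0^{n\times n})$ (extended by zero to $\mathbb R^n$) such that: (i) $\int_{\mathcal O}\tilde w(x)\,dx=0$,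 $\nabla\cdot\tilde n=0$ and $\nabla\cdot\tilde{\mathbf V}-\mathbf B\tilde n=0$, where $(\nabla\cdot\tilde{\mathbf V})_i=\sum_j\partial_j\tilde{\mathbf V}_{ij}$; (ii) $\operatorname{dist}(w+\tilde w(x),[w_1,w_2])<\varepsilon$ for all $x\in\mathcal O$, where $[w_1,w_2]$ is the closed segment from $w_1$ to $w_2$; (iii) there exist two disjoint open sets $\mathcal O_1,\mathcal O_2\subset\mathcal O$ such that, for $i=1,2$, $|w+\tilde w(x)-w_i|<\varepsilon$ for all $x\in\mathcal O_i$, and $\bigl||\mathcal O_i|-\mu_i|\mathcal O|\bigr|<\varepsilon$, where $|\cdot|$ of a set is its Lebesgue measure. -/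

import Mathlib

open MeasureTheory
open scoped ContDiff Matrix

/-- The matrix with entries `A (i, j)`. Elements of `EuclideanSpace ℝ (Fin n × Fin n)` are the real
`n × n` matrices with the Euclidean (Frobenius) norm `|A|² = ∑ᵢⱼ Aᵢⱼ²`. -/
def toMat {n : ℕ} (A : EuclideanSpace ℝ (Fin n × Fin n)) : Matrix (Fin n) (Fin n) ℝ :=
  Matrix.of fun i j => A (i, j)

/-- The space of symmetric trace-free real `n × n` matrices, with the Euclidean norm. -/
def SymTraceless (n : ℕ) : Submodule ℝ (EuclideanSpace ℝ (Fin n × Fin n)) where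
  carrier := {A | (toMat A)ᵀ = toMat A ∧ (toMat A).trace = 0}
  zero_mem' := ⟨rfl, by simp [toMat, Matrix.trace]⟩
  add_mem' := by
    rintro A B ⟨hA, hA'⟩ ⟨hB, hB'⟩
    have h : toMat (A + B) = toMat A + toMat B := rfl
    exact ⟨by rw [h, Matrix.transpose_add, hA, hB],
      by rw [h, Matrix.trace_add, hA', hB', add_zero]⟩
  smul_mem' := by
    rintro c A ⟨hA, hA'⟩
    have h : toMat (c • A) = c • toMat A := rfl
    exact ⟨by rw [h, Matrix.transpose_smul, hA],
      by rw [h, Matrix.trace_smul, hA', smul_zero]⟩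

/-- The state space of pairs (vector, symmetric trace-free matrix), with the Euclidean norm
`|(m, U)|² = |m|² + |U|²`. -/
abbrev State (n : ℕ) : Type :=
  WithLp 2 (EuclideanSpace ℝ (Fin n) × SymTraceless n)

/-- The vector component of a state. -/
def State.vec {n : ℕ} (w : State n) : EuclideanSpace ℝ (Fin n) := w.fst

/-- The matrix component of a state. -/
def State.mat {n : ℕ} (w : State n) : Matrix (Fin n) (Fin n) ℝ :=
  toMat (w.snd : EuclideanSpace ℝ (Fin n × Fin n))

/-- The wave cone: the states `(m, U)` such that `m · η = 0` and `U η = 0` for some nonzero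
vector `η`. -/
def waveCone (n : ℕ) : Set (State n) :=
  {w | ∃ η : EuclideanSpace ℝ (Fin n), η ≠ 0 ∧ inner ℝ w.vec η = 0 ∧ w.mat *ᵥ η.ofLp = 0}

/-- The partial derivative `∂ⱼ f` of a scalar function on `ℝⁿ`. -/
noncomputable def partialD {n : ℕ} (j : Fin n) (f : EuclideanSpace ℝ (Fin n) → ℝ)
    (x : EuclideanSpace ℝ (Fin n)) : ℝ :=
  fderiv ℝ f x (EuclideanSpace.single j 1)

/-- The divergence `∑ⱼ ∂ⱼ vⱼ` of a vector field. -/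
noncomputable def divVec {n : ℕ} (v : EuclideanSpace ℝ (Fin n) → EuclideanSpace ℝ (Fin n))
    (x : EuclideanSpace ℝ (Fin n)) : ℝ :=
  ∑ j, partialD j (fun y => v y j) x

/-- The row-wise divergence of a matrix field: its `i`-th component is `∑ⱼ ∂ⱼ Vᵢⱼ`. -/
noncomputable def divMat {n : ℕ} (V : EuclideanSpace ℝ (Fin n) → Matrix (Fin n) (Fin n) ℝ)
    (x : EuclideanSpace ℝ (Fin n)) : Fin n → ℝ :=
  fun i => ∑ j, partialD j (fun y => V y i j) x

/-!
For `z = w₂ - w₁` in the wave cone with direction `η`, a plane wave `h(N η · x) z` with one-periodic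
profile `h` satisfies the linear system up to the lower order term `B n`. Let `h` have mean zero and
take almost only the values `-μ₂` and `μ₁`, on fractions `μ₁` and `μ₂` of the period: then
`w + h z` oscillates between `w₁` and `w₂` with the right volume fractions.

Localization and the lower order term are handled together by a potential: a homogeneous constant
coefficient operator of order five, plus terms of order four, maps every scalar test function to an
exact solution. Its leading symbol at `η` is a nonzero multiple of `z` (in dimension one `z = 0`),
so that applied to `N⁻⁵ A(N η · x) χ(x)`, where `A` is a periodic fifth primitive of `h` and `χ` a
cutoff, it returns a multiple of `h(N η · x) χ(x) z` with an error of order `N⁻¹`. The solution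
integrates to zero because all symbols vanish at the origin. The volume fractions follow from the
weak convergence of `a(N η · x)` to the mean of the periodic function `a`.
-/

open Filter Topology TopologicalSpace LineDeriv Real
open scoped Distributions

section TestFunction

variable {E F : Type*} [NormedAddCommGroup E] [NormedSpace ℝ E] [NormedAddCommGroup F]
  [NormedSpace ℝ F] {Ω : Opens E}

theorem lineDerivOp_apply (v : E) (φ : 𝓓(Ω, F)) (x : E) : (∂_{v} φ) x = fderiv ℝ φ x v := by
  rw [TestFunction.lineDerivOp_eq_lineDerivCLM ℝ, TestFunction.lineDerivCLM_eq_fderivCLM,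
    TestFunction.fderivCLM_apply]
  simp

theorem lineDerivOp_comm (u v : E) (φ : 𝓓(Ω, F)) :
    (∂_{u} (∂_{v} φ) : 𝓓(Ω, F)) = ∂_{v} (∂_{u} φ) := by
  have second_deriv (u v x : E) :
      (∂_{u} (∂_{v} φ) : 𝓓(Ω, F)) x = fderiv ℝ (fderiv ℝ φ) x u v := by
    have hdiff : DifferentiableAt ℝ (fderiv ℝ φ) x :=
      (φ.contDiff.fderiv_right (m := ∞) (by simp)).differentiable (by simp) x
    have hv : ⇑(∂_{v} φ : 𝓓(Ω, F)) = fun y => fderiv ℝ φ y v :=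
      funext (lineDerivOp_apply v φ)
    rw [lineDerivOp_apply, hv, fderiv_clm_apply hdiff (differentiableAt_const v)]
    simp
  ext x
  rw [second_deriv, second_deriv]
  have htwo : (2 : WithTop ℕ∞) ≤ ∞ := WithTop.coe_le_coe.2 (le_top : (2 : ℕ∞) ≤ ⊤)
  exact φ.contDiff.contDiffAt.isSymmSndFDerivAt (by simpa using htwo) u v

theorem integrable_testFunction [MeasurableSpace E] [OpensMeasurableSpace E] (μ : Measure E)
    [IsFiniteMeasureOnCompacts μ] (φ : 𝓓(Ω, F)) : Integrable φ μ :=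
  φ.continuous.integrable_of_hasCompactSupport φ.hasCompactSupport

theorem integral_lineDerivOp [FiniteDimensional ℝ E] [MeasurableSpace E] [BorelSpace E]
    (μ : Measure E) [μ.IsAddHaarMeasure] (v : E) (φ : 𝓓(Ω, F)) :
    ∫ x, (∂_{v} φ) x ∂μ = 0 := by
  have by_parts := integral_smul_fderiv_eq_neg_fderiv_smul_of_integrable (μ := μ) (v := v)
    (f := fun _ : E => (1 : ℝ)) (g := φ) (by simp)
    (by simpa only [one_smul, ← lineDerivOp_apply] using integrable_testFunction μ (∂_{v} φ))
    (by simpa only [one_smul] using integrable_testFunction μ φ)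
    (fun x _ => differentiableAt_const _)
    (fun x _ => φ.contDiff.differentiable (by simp) x)
  simpa [← lineDerivOp_apply] using by_parts

end TestFunction

section aevalOfComm

variable {R A σ : Type*} [CommRing R] [Ring A] [Algebra R A] (a : σ → A)
  (h : ∀ i j, a i * a j = a j * a i)

open scoped IsMulCommutative in
/-- Evaluation of a polynomial at a pairwise commuting family of a possibly noncommutative algebra,
computed in the commutative subalgebra generated by the family. -/
noncomputable def aevalOfComm : MvPolynomial σ R →ₐ[R] A :=
  haveI : IsMulCommutative (Algebra.adjoin R (Set.range a)) :=
    Algebra.isMulCommutative_adjoin R (by rintro _ ⟨i, rfl⟩ _ ⟨j, rfl⟩; exact h i j)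
  (Algebra.adjoin R (Set.range a)).val.comp
    (MvPolynomial.aeval fun j => ⟨a j, Algebra.subset_adjoin ⟨j, rfl⟩⟩)

theorem aevalOfComm_X (j : σ) : aevalOfComm (R := R) a h (.X j) = a j := by
  simp [aevalOfComm]

end aevalOfComm

section DiffOp

variable {E F ι : Type*} [NormedAddCommGroup E] [NormedSpace ℝ E] [NormedAddCommGroup F]
  [NormedSpace ℝ F] {Ω : Opens E}

/-- The constant coefficient differential operator `p(∂)` with symbol `p`, where the variable `X j`
acts as the derivative in the direction `e j`. -/
noncomputable def diffOp (e : ι → E) : MvPolynomial ι ℝ →ₐ[ℝ] Module.End ℝ 𝓓(Ω, F) :=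
  aevalOfComm (fun j => (lineDerivOpCLM ℝ 𝓓(Ω, F) (e j) : Module.End ℝ 𝓓(Ω, F)))
    fun i j => LinearMap.ext fun φ => lineDerivOp_comm (e i) (e j) φ

variable (e : ι → E) (p : MvPolynomial ι ℝ) (φ : 𝓓(Ω, F))

theorem diffOp_C (c : ℝ) : diffOp e (.C c) φ = c • φ := by
  rw [← MvPolynomial.algebraMap_eq, AlgHom.commutes, Module.algebraMap_end_apply]

theorem diffOp_mul_X (j : ι) : diffOp e (p * .X j) φ = diffOp e p (∂_{e j} φ) := by
  rw [map_mul, diffOp, aevalOfComm_X]; rfl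

theorem diffOp_X_mul (j : ι) : diffOp e (.X j * p) φ = ∂_{e j} (diffOp e p φ) := by
  rw [map_mul, diffOp, aevalOfComm_X]; rfl

theorem sum_lineDerivOp_diffOp [Fintype ι] (s : ι → MvPolynomial ι ℝ) :
    ∑ j, ∂_{e j} (diffOp e (s j) φ) = diffOp e (s ⬝ᵥ .X) φ := by
  simp only [dotProduct, map_sum, LinearMap.sum_apply, ← diffOp_X_mul, mul_comm]

theorem integral_diffOp [FiniteDimensional ℝ E] [MeasurableSpace E] [BorelSpace E]
    (μ : Measure E) [μ.IsAddHaarMeasure] :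
    ∫ x, diffOp e p φ x ∂μ = MvPolynomial.constantCoeff p • ∫ x, φ x ∂μ := by
  induction p using MvPolynomial.induction_on generalizing φ with
  | C c => simp only [diffOp_C, smul_apply, integral_smul, MvPolynomial.constantCoeff_C]
  | add p q hp hq =>
    simp only [map_add, LinearMap.add_apply, add_apply, add_smul, ← hp, ← hq]
    exact integral_add (integrable_testFunction μ _) (integrable_testFunction μ _)
  | mul_X p j hp =>
    rw [diffOp_mul_X, hp, integral_lineDerivOp, map_mul, MvPolynomial.constantCoeff_X, mul_zero,
      smul_zero, zero_smul]

end DiffOp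

/-- Smooth functions on the line of period one, the profiles of plane waves. -/
@[ext]
structure PeriodicProfile where
  toFun : ℝ → ℝ
  contDiff : ContDiff ℝ ∞ toFun
  periodic : Function.Periodic toFun 1

namespace PeriodicProfile

instance : CoeFun PeriodicProfile fun _ => ℝ → ℝ := ⟨toFun⟩

variable (G : PeriodicProfile)

theorem continuous : Continuous G := G.contDiff.continuous

theorem hasDerivAt (s : ℝ) : HasDerivAt G (_root_.deriv G s) s :=
  (G.contDiff.differentiable (by simp) s).hasDerivAt

theorem exists_abs_le : ∃ C, ∀ s, |G s| ≤ C := by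
  obtain ⟨C, hC⟩ := (isCompact_Icc (a := (0 : ℝ)) (b := 1)).exists_bound_of_continuousOn
    G.continuous.continuousOn
  refine ⟨C, fun s => ?_⟩
  obtain ⟨t, ht, hst⟩ := G.periodic.exists_mem_Ico₀ one_pos s
  exact hst ▸ hC t ⟨ht.1, ht.2.le⟩

/-- The derivative of a periodic profile, again a periodic profile. -/
noncomputable def deriv : PeriodicProfile where
  toFun := _root_.deriv G
  contDiff := (contDiff_infty_iff_deriv.1 G.contDiff).2
  periodic s := by rw [← deriv_comp_add_const, funext G.periodic]

/-- A periodic profile shifted by a constant. -/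
noncomputable def subConst (c : ℝ) : PeriodicProfile where
  toFun s := G s - c
  contDiff := G.contDiff.sub contDiff_const
  periodic s := by simp only [G.periodic s]

theorem integral_subConst (c : ℝ) :
    ∫ s in (0 : ℝ)..1, G.subConst c s = (∫ s in (0 : ℝ)..1, G s) - c := by
  simp only [subConst]
  rw [intervalIntegral.integral_sub (G.continuous.intervalIntegrable _ _) (by simp)]
  simp

theorem deriv_subConst (c : ℝ) : (G.subConst c).deriv = G.deriv := by
  simp [deriv, subConst]

variable {G}

theorem exists_deriv_eq (hG : ∫ s in (0 : ℝ)..1, G s = 0) :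
    ∃ A : PeriodicProfile, A.deriv = G ∧ ∫ s in (0 : ℝ)..1, A s = 0 := by
  have hderiv (t : ℝ) : HasDerivAt (fun t => ∫ s in (0 : ℝ)..t, G s) (G t) t :=
    intervalIntegral.integral_hasDerivAt_right (G.continuous.intervalIntegrable _ _)
      (G.continuous.stronglyMeasurableAtFilter _ _) G.continuous.continuousAt
  have deriv_eq : _root_.deriv (fun t => ∫ s in (0 : ℝ)..t, G s) = G :=
    funext fun t => (hderiv t).deriv
  let P : PeriodicProfile :=
    { toFun t := ∫ s in (0 : ℝ)..t, G s
      contDiff := contDiff_infty_iff_deriv.2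
        ⟨fun t => (hderiv t).differentiableAt, by rw [deriv_eq]; exact G.contDiff⟩
      periodic t := by
        beta_reduce
        rw [← intervalIntegral.integral_add_adjacent_intervals (b := t)
          (G.continuous.intervalIntegrable _ _) (G.continuous.intervalIntegrable _ _),
          G.periodic.intervalIntegral_add_eq t 0, zero_add, hG, add_zero] }
  have hP : P.deriv = G := PeriodicProfile.ext deriv_eq
  exact ⟨P.subConst (∫ s in (0 : ℝ)..1, P s), by rw [deriv_subConst, hP],
    by rw [integral_subConst, sub_self]⟩

theorem exists_iterate_deriv_eq (hG : ∫ s in (0 : ℝ)..1, G s = 0) (k : ℕ) :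
    ∃ A : PeriodicProfile, deriv^[k] A = G := by
  induction k generalizing G with
  | zero => exact ⟨G, rfl⟩
  | succ k ih =>
    obtain ⟨A, rfl, hA⟩ := exists_deriv_eq hG
    obtain ⟨A', rfl⟩ := ih hA
    exact ⟨A', Function.iterate_succ_apply' _ _ _⟩

end PeriodicProfile

section PlaneWave

variable {E F : Type*} [NormedAddCommGroup E] [NormedSpace ℝ E] [NormedAddCommGroup F]
  [NormedSpace ℝ F] {Ω : Opens E}

/-- The localized plane wave `x ↦ G (N L(x)) χ(x)` of frequency `N` in the direction of the
covector `L`. -/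
noncomputable def planeWave (L : E →L[ℝ] ℝ) (G : PeriodicProfile) (χ : 𝓓(Ω, F)) (N : ℝ) :
    𝓓(Ω, F) where
  toFun x := G (N * L x) • χ x
  contDiff' := (G.contDiff.comp (contDiff_const.mul L.contDiff)).smul χ.contDiff
  hasCompactSupport' := χ.hasCompactSupport.smul_left
  tsupport_subset' := (tsupport_smul_subset_right _ _).trans χ.tsupport_subset

variable (L : E →L[ℝ] ℝ) (G : PeriodicProfile) (χ : 𝓓(Ω, F)) (N : ℝ)

theorem planeWave_apply (x : E) : planeWave L G χ N x = G (N * L x) • χ x := rfl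

theorem lineDerivOp_planeWave (v : E) :
    ∂_{v} (planeWave L G χ N) =
      (N * L v) • planeWave L G.deriv χ N + planeWave L G (∂_{v} χ) N := by
  ext x
  have hphase : HasFDerivAt (fun y => N * L y) (N • L) x := L.hasFDerivAt.const_mul N
  have hwave := ((G.hasDerivAt (N * L x)).comp_hasFDerivAt x hphase).smul
    (χ.contDiff.differentiable (by simp) x).hasFDerivAt
  rw [lineDerivOp_apply, add_apply, smul_apply, planeWave_apply, planeWave_apply, lineDerivOp_apply]
  refine (congr($(hwave.fderiv) v)).trans ?_
  simp only [PeriodicProfile.deriv, Function.comp_apply, add_apply, smul_apply,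
    ContinuousLinearMap.smulRight_apply, smul_eq_mul]
  module

theorem exists_norm_planeWave_le : ∃ C, ∀ N x, ‖planeWave L G χ N x‖ ≤ C := by
  obtain ⟨C, hC⟩ := G.exists_abs_le
  obtain ⟨D, hD⟩ := χ.hasCompactSupport.exists_bound_of_continuous χ.continuous
  refine ⟨C * D, fun N x => ?_⟩
  rw [planeWave_apply, norm_smul]
  exact mul_le_mul (hC _) (hD x) (norm_nonneg _) ((abs_nonneg _).trans (hC 0))

end PlaneWave

section PrincipalValue

variable {E F ι : Type*} [NormedAddCommGroup E] [NormedSpace ℝ E] [NormedAddCommGroup F]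
  [NormedSpace ℝ F]

variable (F) in
/-- The symbol `p` has principal value `c` at order `k` along the covector `L`: uniformly in space,
`p(∂)` acts on plane waves of large frequency `N` as `c N ^ k` times the `k`-th derivative of the
profile, up to an error `o(N ^ k)`. -/
def HasPrincipalValue (Ω : Opens E) (e : ι → E) (L : E →L[ℝ] ℝ) (k : ℕ) (p : MvPolynomial ι ℝ)
    (c : ℝ) : Prop :=
  ∀ (G : PeriodicProfile) (χ : 𝓓(Ω, F)), Tendsto (fun q : ℝ × E =>
    (q.1 ^ k)⁻¹ • diffOp e p (planeWave L G χ q.1) q.2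
      - c • planeWave L (PeriodicProfile.deriv^[k] G) χ q.1 q.2) (atTop ×ˢ ⊤) (𝓝 0)

theorem tendsto_inv_smul_planeWave {Ω : Opens E} (L : E →L[ℝ] ℝ) (G : PeriodicProfile)
    (χ : 𝓓(Ω, F)) :
    Tendsto (fun q : ℝ × E => q.1⁻¹ • planeWave L G χ q.1 q.2) (atTop ×ˢ ⊤) (𝓝 0) := by
  obtain ⟨C, hC⟩ := exists_norm_planeWave_le L G χ
  exact (tendsto_inv_atTop_zero.comp tendsto_fst).zero_smul_isBoundedUnder_le
    (isBoundedUnder_of ⟨C, fun q => hC q.1 q.2⟩)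

namespace HasPrincipalValue

variable {Ω : Opens E} {e : ι → E} {L : E →L[ℝ] ℝ} {k : ℕ} {p p' : MvPolynomial ι ℝ} {c c' : ℝ}

theorem C (c : ℝ) : HasPrincipalValue F Ω e L 0 (.C c) c := fun G χ => by
  simp

theorem add (h : HasPrincipalValue F Ω e L k p c) (h' : HasPrincipalValue F Ω e L k p' c') :
    HasPrincipalValue F Ω e L k (p + p') (c + c') := fun G χ => by
  refine ((add_zero (0 : F)) ▸ (h G χ).add (h' G χ)).congr fun q => ?_
  simp only [map_add, LinearMap.add_apply, add_apply]
  module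

theorem sum {κ : Type*} {s : Finset κ} {p : κ → MvPolynomial ι ℝ} {c : κ → ℝ}
    (h : ∀ i ∈ s, HasPrincipalValue F Ω e L k (p i) (c i)) :
    HasPrincipalValue F Ω e L k (∑ i ∈ s, p i) (∑ i ∈ s, c i) := by
  classical
  induction s using Finset.induction_on with
  | empty => intro G χ; simp
  | insert i s hi ih =>
    rw [Finset.sum_insert hi, Finset.sum_insert hi]
    exact (h i (s.mem_insert_self i)).add (ih fun j hj => h j (Finset.mem_insert_of_mem hj))

theorem tendsto_succ (h : HasPrincipalValue F Ω e L k p c) (G : PeriodicProfile) (χ : 𝓓(Ω, F)) :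
    Tendsto (fun q : ℝ × E => (q.1 ^ (k + 1))⁻¹ • diffOp e p (planeWave L G χ q.1) q.2)
      (atTop ×ˢ ⊤) (𝓝 0) := by
  have hrem := (tendsto_inv_atTop_zero.comp tendsto_fst).smul (h G χ)
  have hmain := (tendsto_inv_smul_planeWave L (PeriodicProfile.deriv^[k] G) χ).const_smul c
  simp only [smul_zero] at hrem hmain
  refine ((add_zero (0 : F)) ▸ hrem.add hmain).congr fun q => ?_
  rw [pow_succ, mul_inv, Function.comp_apply]
  module

theorem succ (h : HasPrincipalValue F Ω e L k p c) : HasPrincipalValue F Ω e L (k + 1) p 0 :=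
  fun G χ => by simpa only [zero_smul, sub_zero] using h.tendsto_succ G χ

theorem mul_X (h : HasPrincipalValue F Ω e L k p c) (j : ι) :
    HasPrincipalValue F Ω e L (k + 1) (p * .X j) (c * L (e j)) := fun G χ => by
  have hprofile := (h G.deriv χ).const_smul (L (e j))
  rw [smul_zero] at hprofile
  refine ((add_zero (0 : F)) ▸ hprofile.add (h.tendsto_succ G (∂_{e j} χ))).congr' ?_
  filter_upwards [tendsto_fst (eventually_ne_atTop (0 : ℝ))] with q hq
  have hpow : (q.1 ^ (k + 1))⁻¹ * (q.1 * L (e j)) = L (e j) * (q.1 ^ k)⁻¹ := by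
    have : q.1 ≠ 0 := hq
    field_simp
    ring
  simp only [diffOp_mul_X, lineDerivOp_planeWave, map_add, map_smul, add_apply, smul_apply,
    smul_add, smul_smul, hpow, Function.iterate_succ_apply]
  module

theorem monomial (d : ι →₀ ℕ) (a : ℝ) :
    HasPrincipalValue F Ω e L d.degree (.monomial d a)
      ((MvPolynomial.monomial d a).eval fun j => L (e j)) := by
  suffices h : ∃ k, (MvPolynomial.monomial d a).IsHomogeneous k ∧
      HasPrincipalValue F Ω e L k (.monomial d a)
        ((MvPolynomial.monomial d a).eval fun j => L (e j)) by
    obtain ⟨k, hk, hval⟩ := h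
    rcases eq_or_ne a 0 with rfl | ha
    · intro G χ; simp
    · rwa [(MvPolynomial.isHomogeneous_monomial a rfl).inj_right hk (by simpa)]
  refine MvPolynomial.induction_on_monomial (motive := fun p => ∃ k, p.IsHomogeneous k ∧
    HasPrincipalValue F Ω e L k p (p.eval fun j => L (e j))) (fun c => ?_) ?_ d a
  · exact ⟨0, MvPolynomial.isHomogeneous_C _ c, by simpa using C c⟩
  · rintro p j ⟨k, hk, hval⟩
    exact ⟨k + 1, hk.mul (MvPolynomial.isHomogeneous_X _ j), by simpa using hval.mul_X j⟩

end HasPrincipalValue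

theorem hasPrincipalValue_of_isHomogeneous {p : MvPolynomial ι ℝ} {k : ℕ} (hp : p.IsHomogeneous k)
    (Ω : Opens E) (e : ι → E) (L : E →L[ℝ] ℝ) :
    HasPrincipalValue F Ω e L k p (p.eval fun j => L (e j)) := by
  have hmonomial (d) (hd : d ∈ p.support) : HasPrincipalValue F Ω e L k
      (.monomial d (p.coeff d)) ((MvPolynomial.monomial d (p.coeff d)).eval fun j => L (e j)) := by
    have hdegree : d.degree = k := (hp.degree_eq_sum_deg_support hd).symm
    exact hdegree ▸ .monomial d (p.coeff d)
  have hsum := HasPrincipalValue.sum hmonomial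
  rwa [← map_sum, MvPolynomial.support_sum_monomial_coeff] at hsum

end PrincipalValue

section Equidistribution

variable {E F : Type*} [NormedAddCommGroup E] [NormedSpace ℝ E] [MeasurableSpace E] [BorelSpace E]
  [NormedAddCommGroup F] [NormedSpace ℝ F] {Ω : Opens E} (μ : Measure E)

theorem exists_norm_integral_planeWave_le [IsFiniteMeasureOnCompacts μ] (L : E →L[ℝ] ℝ)
    (G : PeriodicProfile) (f : 𝓓(Ω, F)) : ∃ C, ∀ N, ‖∫ x, planeWave L G f N x ∂μ‖ ≤ C := by
  obtain ⟨C, hC⟩ := G.exists_abs_le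
  refine ⟨∫ x, C * ‖f x‖ ∂μ, fun N => norm_integral_le_of_norm_le
    ((integrable_testFunction μ f).norm.const_mul C) (.of_forall fun x => ?_)⟩
  rw [planeWave_apply, norm_smul]
  exact mul_le_mul_of_nonneg_right (hC _) (norm_nonneg _)

variable [FiniteDimensional ℝ E] [μ.IsAddHaarMeasure]

theorem tendsto_integral_planeWave_of_integral_eq_zero {L : E →L[ℝ] ℝ} (hL : L ≠ 0)
    {G : PeriodicProfile} (hG : ∫ s in (0 : ℝ)..1, G s = 0) (f : 𝓓(Ω, F)) :
    Tendsto (fun N => ∫ x, planeWave L G f N x ∂μ) atTop (𝓝 0) := by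
  obtain ⟨v, hv⟩ := L.exists_ne_zero hL
  obtain ⟨A, rfl, -⟩ := PeriodicProfile.exists_deriv_eq hG
  obtain ⟨C, hC⟩ := exists_norm_integral_planeWave_le μ L A (∂_{v} f)
  have by_parts (N : ℝ) : (N * L v) • ∫ x, planeWave L A.deriv f N x ∂μ =
      -∫ x, planeWave L A (∂_{v} f) N x ∂μ := by
    rw [← add_eq_zero_iff_eq_neg, ← integral_smul, ← integral_add
      ((integrable_testFunction μ _).fun_smul _) (integrable_testFunction μ _),
      ← integral_lineDerivOp μ v (planeWave L A f N), lineDerivOp_planeWave]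
    rfl
  have hlim : Tendsto (fun N : ℝ => (N * L v)⁻¹ • -∫ x, planeWave L A (∂_{v} f) N x ∂μ)
      atTop (𝓝 0) := by
    have hinv : Tendsto (fun N : ℝ => (N * L v)⁻¹) atTop (𝓝 0) := by
      simpa only [mul_inv, zero_mul] using tendsto_inv_atTop_zero.mul_const (L v)⁻¹
    exact hinv.zero_smul_isBoundedUnder_le
      (isBoundedUnder_of ⟨C, fun N => by simpa only [Function.comp_apply, norm_neg] using hC N⟩)
  refine hlim.congr' ?_
  filter_upwards [eventually_ne_atTop 0] with N hN
  rw [← by_parts, inv_smul_smul₀ (mul_ne_zero hN hv)]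

theorem tendsto_integral_planeWave {L : E →L[ℝ] ℝ} (hL : L ≠ 0) (G : PeriodicProfile)
    (f : 𝓓(Ω, F)) :
    Tendsto (fun N => ∫ x, planeWave L G f N x ∂μ) atTop
      (𝓝 ((∫ s in (0 : ℝ)..1, G s) • ∫ x, f x ∂μ)) := by
  set m := ∫ s in (0 : ℝ)..1, G s
  have hcentred := tendsto_integral_planeWave_of_integral_eq_zero μ hL
    (G := G.subConst m) (by rw [PeriodicProfile.integral_subConst, sub_self]) f
  refine ((zero_add (m • ∫ x, f x ∂μ)) ▸ hcentred.add_const _).congr fun N => ?_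
  rw [← integral_smul, ← integral_add (integrable_testFunction μ _)
    ((integrable_testFunction μ f).fun_smul m)]
  refine integral_congr_ae (.of_forall fun x => ?_)
  simp only [planeWave_apply, PeriodicProfile.subConst]
  module

end Equidistribution

section SmoothTransition

variable {α : Type*} [MeasurableSpace α] (ν : Measure α) [IsFiniteMeasure ν] {g : α → ℝ}

theorem tendsto_integral_smoothTransition (hg : Measurable g) {b : ℝ} (hb : 0 ≤ b) :
    Tendsto (fun K : ℝ => ∫ x, smoothTransition (K * g x - b) ∂ν) atTop
      (𝓝 (ν.real {x | 0 < g x})) := by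
  have hmeas : MeasurableSet {x | 0 < g x} := measurableSet_lt measurable_const hg
  rw [← integral_indicator_one hmeas]
  refine tendsto_integral_filter_of_dominated_convergence (fun _ => 1) (.of_forall fun K => ?_)
    (.of_forall fun K => .of_forall fun x => ?_) (integrable_const 1) (.of_forall fun x => ?_)
  · exact (smoothTransition.continuous.measurable.comp
      ((hg.const_mul K).sub_const b)).aestronglyMeasurable
  · rw [norm_of_nonneg (smoothTransition.nonneg _)]
    exact smoothTransition.le_one _
  by_cases hx : 0 < g x
  · rw [Set.indicator_of_mem (show x ∈ {x | 0 < g x} from hx), Pi.one_apply]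
    have hlarge : Tendsto (fun K : ℝ => K * g x - b) atTop atTop :=
      tendsto_atTop_add_const_right _ _ (tendsto_id.atTop_mul_const hx)
    exact tendsto_const_nhds.congr' ((hlarge.eventually_ge_atTop 1).mono fun K hK =>
      (smoothTransition.one_of_one_le hK).symm)
  · rw [Set.indicator_of_notMem (show x ∉ {x | 0 < g x} from hx)]
    refine tendsto_const_nhds.congr' ((eventually_ge_atTop 0).mono fun K hK => ?_)
    exact (smoothTransition.zero_of_nonpos (by nlinarith)).symm

theorem integral_smoothTransition_le (hg : Measurable g) {K : ℝ} (hK : 0 ≤ K) :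
    ∫ x, smoothTransition (K * g x) ∂ν ≤ ν.real {x | 0 < g x} := by
  have hmeas : MeasurableSet {x | 0 < g x} := measurableSet_lt measurable_const hg
  rw [← integral_indicator_one hmeas]
  refine integral_mono_of_nonneg (.of_forall fun x => smoothTransition.nonneg _)
    ((integrable_const 1).indicator hmeas) (.of_forall fun x => ?_)
  by_cases hx : 0 < g x
  · simpa [Set.indicator_of_mem, hx] using smoothTransition.le_one _
  · simp [hx, smoothTransition.zero_of_nonpos (mul_nonpos_of_nonneg_of_nonpos hK (not_lt.1 hx))]

end SmoothTransition

namespace PeriodicProfile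

/-- The profile `s ↦ σ (K g(s) - b)`, with `σ` a smooth transition from `0` to `1`: a smooth
approximation of the indicator function of `{g > 0}` when `K` is large. -/
noncomputable def transition (g : PeriodicProfile) (K b : ℝ) : PeriodicProfile where
  toFun s := smoothTransition (K * g s - b)
  contDiff := smoothTransition.contDiff.comp ((contDiff_const.mul g.contDiff).sub contDiff_const)
  periodic s := by simp only [g.periodic s]

theorem transition_mem_Icc (g : PeriodicProfile) (K b s : ℝ) :
    g.transition K b s ∈ Set.Icc 0 1 :=
  ⟨smoothTransition.nonneg _, smoothTransition.le_one _⟩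

theorem transition_eq_one {g : PeriodicProfile} {K b s : ℝ} (h : 1 + b ≤ K * g s) :
    g.transition K b s = 1 :=
  smoothTransition.one_of_one_le (by linarith)

theorem transition_eq_zero {g : PeriodicProfile} {K b s : ℝ} (h : K * g s ≤ b) :
    g.transition K b s = 0 :=
  smoothTransition.zero_of_nonpos (by linarith)

theorem lt_of_transition_ne_zero {g : PeriodicProfile} {K b s : ℝ}
    (h : g.transition K b s ≠ 0) : b < K * g s :=
  not_le.1 fun hle => h (transition_eq_zero hle)

/-- The negative of a periodic profile. -/
noncomputable def neg (g : PeriodicProfile) : PeriodicProfile where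
  toFun s := -g s
  contDiff := g.contDiff.neg
  periodic s := by simp only [g.periodic s]

theorem neg_apply (g : PeriodicProfile) (s : ℝ) : g.neg s = -g s := rfl

/-- The profile `s ↦ cos (π (2 s - 1)) - cos (π m)`. On the period `(0, 1]` it is positive exactly
where `|2 s - 1| < m`, a set of length `m`, and negative exactly where `m < |2 s - 1|`. -/
noncomputable def cosProfile (m : ℝ) : PeriodicProfile where
  toFun s := cos (π * (2 * s - 1)) - cos (π * m)
  contDiff := by fun_prop
  periodic s := by
    beta_reduce
    rw [← cos_add_two_pi (π * (2 * s - 1))]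
    ring_nf

section CosProfile

variable {m s : ℝ}

theorem cosProfile_eq (m s : ℝ) : cosProfile m s = cos (π * |2 * s - 1|) - cos (π * m) := by
  rw [← abs_of_pos pi_pos, ← abs_mul, Real.cos_abs, abs_of_pos pi_pos, cosProfile]

theorem strictAntiOn_cos_pi_mul : StrictAntiOn (fun t => cos (π * t)) (Set.Icc 0 1) :=
  fun _ hs _ ht hst => strictAntiOn_cos
    ⟨mul_nonneg pi_nonneg hs.1, mul_le_of_le_one_right pi_nonneg hs.2⟩
    ⟨mul_nonneg pi_nonneg ht.1, mul_le_of_le_one_right pi_nonneg ht.2⟩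
    (mul_lt_mul_of_pos_left hst pi_pos)

theorem abs_two_mul_sub_one_mem_Icc (hs : s ∈ Set.Ioc 0 1) : |2 * s - 1| ∈ Set.Icc 0 1 :=
  ⟨abs_nonneg _, abs_le.2 ⟨by linarith [hs.1], by linarith [hs.2]⟩⟩

theorem cosProfile_pos_iff (hm : m ∈ Set.Icc 0 1) (hs : s ∈ Set.Ioc 0 1) :
    0 < cosProfile m s ↔ |2 * s - 1| < m := by
  rw [cosProfile_eq, sub_pos,
    strictAntiOn_cos_pi_mul.lt_iff_gt hm (abs_two_mul_sub_one_mem_Icc hs)]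

theorem neg_cosProfile_pos_iff (hm : m ∈ Set.Icc 0 1) (hs : s ∈ Set.Ioc 0 1) :
    0 < (cosProfile m).neg s ↔ m < |2 * s - 1| := by
  rw [neg_apply, cosProfile_eq, neg_sub, sub_pos,
    strictAntiOn_cos_pi_mul.lt_iff_gt (abs_two_mul_sub_one_mem_Icc hs) hm]

theorem volume_cosProfile_pos (hm : m ∈ Set.Icc 0 1) :
    (volume.restrict (Set.Ioc 0 1)).real {s | 0 < cosProfile m s} = m := by
  obtain ⟨hm₀, hm₁⟩ := id hm
  have hset : {s | 0 < cosProfile m s} ∩ Set.Ioc 0 1 = Set.Ioo ((1 - m) / 2) ((1 + m) / 2) := by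
    ext s
    refine ⟨fun hs => ?_, fun hs => ?_⟩
    · obtain ⟨h₁, h₂⟩ := abs_lt.1 ((cosProfile_pos_iff hm hs.2).1 hs.1)
      exact ⟨by linarith, by linarith⟩
    · have hmem : s ∈ Set.Ioc 0 1 := ⟨by linarith [hs.1], by linarith [hs.2]⟩
      have habs : |2 * s - 1| < m := abs_lt.2 ⟨by linarith [hs.1], by linarith [hs.2]⟩
      exact ⟨(cosProfile_pos_iff hm hmem).2 habs, hmem⟩
  rw [measureReal_restrict_apply' measurableSet_Ioc, hset,
    Real.volume_real_Ioo_of_le (by linarith)]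
  ring

theorem volume_neg_cosProfile_pos (hm : m ∈ Set.Icc 0 1) :
    (volume.restrict (Set.Ioc 0 1)).real {s | 0 < (cosProfile m).neg s} = 1 - m := by
  obtain ⟨hm₀, hm₁⟩ := id hm
  have hset : {s | 0 < (cosProfile m).neg s} ∩ Set.Ioc 0 1 =
      Set.Ioo 0 ((1 - m) / 2) ∪ Set.Ioc ((1 + m) / 2) 1 := by
    ext s
    refine ⟨fun hs => ?_, fun hs => ?_⟩
    · obtain h | h := lt_abs.1 ((neg_cosProfile_pos_iff hm hs.2).1 hs.1)
      · exact .inr ⟨by linarith, hs.2.2⟩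
      · exact .inl ⟨hs.2.1, by linarith⟩
    · have hmem : s ∈ Set.Ioc 0 1 := by
        obtain h | h := hs
        · exact ⟨h.1, by linarith [h.2]⟩
        · exact ⟨by linarith [h.1], h.2⟩
      have habs : m < |2 * s - 1| := lt_abs.2 <| hs.symm.imp
        (fun h => by linarith [h.1]) fun h => by linarith [h.2]
      exact ⟨(neg_cosProfile_pos_iff hm hmem).2 habs, hmem⟩
  have hdisj : Disjoint (Set.Ioo 0 ((1 - m) / 2)) (Set.Ioc ((1 + m) / 2) 1) :=
    Set.disjoint_left.2 fun s hs ht => by linarith [hs.2, ht.1]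
  rw [measureReal_restrict_apply' measurableSet_Ioc, hset, measureReal_union hdisj
    measurableSet_Ioc measure_Ioo_lt_top.ne measure_Ioc_lt_top.ne,
    Real.volume_real_Ioo_of_le (by linarith), Real.volume_real_Ioc_of_le (by linarith)]
  ring

end CosProfile

theorem exists_meanZero_of_transition (g : PeriodicProfile) (K : ℝ) {m : ℝ}
    (hneg : ∫ s in (0 : ℝ)..1, g.neg.transition K 0 s ≤ m)
    (hpos : ∫ s in (0 : ℝ)..1, g.transition K 0 s ≤ 1 - m) :
    ∃ h : PeriodicProfile, ∫ s in (0 : ℝ)..1, h s = 0 ∧ (∀ s, h s ∈ Set.Icc (-m) (1 - m)) ∧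
      (∀ s, g.transition K 1 s ≠ 0 → h s = -m) ∧
      ∀ s, g.neg.transition K 1 s ≠ 0 → h s = 1 - m := by
  have hsegment : m ∈ segment ℝ (∫ s in (0 : ℝ)..1, g.neg.transition K 0 s)
      (1 - ∫ s in (0 : ℝ)..1, g.transition K 0 s) := by
    rw [segment_eq_Icc (by linarith)]
    exact ⟨hneg, by linarith⟩
  obtain ⟨a, b, ha, hb, hab, hm⟩ := hsegment
  let h : PeriodicProfile :=
    { toFun s := a * g.neg.transition K 0 s + b * (1 - g.transition K 0 s) - m
      contDiff := ((contDiff_const.mul (g.neg.transition K 0).contDiff).add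
        (contDiff_const.mul (contDiff_const.sub (g.transition K 0).contDiff))).sub contDiff_const
      periodic s := by
        simp only [(g.neg.transition K 0).periodic s, (g.transition K 0).periodic s] }
  have h_apply (s : ℝ) : h s = a * g.neg.transition K 0 s + b * (1 - g.transition K 0 s) - m := rfl
  refine ⟨h, ?_, fun s => ?_, fun s hs => ?_, fun s hs => ?_⟩
  · have hint (P : PeriodicProfile) : IntervalIntegrable P volume 0 1 :=
      P.continuous.intervalIntegrable _ _
    have hone : IntervalIntegrable (fun _ => (1 : ℝ)) volume 0 1 := intervalIntegrable_const
    simp only [h_apply]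
    rw [intervalIntegral.integral_sub (((hint _).const_mul _).add ((hone.sub (hint _)).const_mul _))
      intervalIntegrable_const, intervalIntegral.integral_add ((hint _).const_mul _)
      ((hone.sub (hint _)).const_mul _), intervalIntegral.integral_const_mul,
      intervalIntegral.integral_const_mul, intervalIntegral.integral_sub hone (hint _)]
    simpa [sub_eq_zero] using hm
  · obtain ⟨hn₀, hn₁⟩ := g.neg.transition_mem_Icc K 0 s
    obtain ⟨hp₀, hp₁⟩ := g.transition_mem_Icc K 0 s
    rw [h_apply]
    constructor <;> nlinarith
  · have hlarge := lt_of_transition_ne_zero hs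
    rw [h_apply, transition_eq_one (g := g) (by linarith),
      transition_eq_zero (by rw [neg_apply]; linarith)]
    ring
  · have hlarge := lt_of_transition_ne_zero hs
    rw [h_apply, transition_eq_one (g := g.neg) (by linarith),
      transition_eq_zero (by rw [neg_apply] at hlarge; linarith)]
    linear_combination hab

theorem eventually_lt_integral_transition (g : PeriodicProfile) {c : ℝ}
    (hc : c < (volume.restrict (Set.Ioc 0 1)).real {s | 0 < g s}) :
    ∀ᶠ K in atTop, c < ∫ s in (0 : ℝ)..1, g.transition K 1 s := by
  simp only [intervalIntegral.integral_of_le zero_le_one]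
  exact (tendsto_integral_smoothTransition _ g.continuous.measurable zero_le_one).eventually
    (lt_mem_nhds hc)

theorem integral_transition_le (g : PeriodicProfile) {K : ℝ} (hK : 0 ≤ K) :
    ∫ s in (0 : ℝ)..1, g.transition K 0 s ≤
      (volume.restrict (Set.Ioc 0 1)).real {s | 0 < g s} := by
  simpa only [intervalIntegral.integral_of_le zero_le_one, transition, sub_zero] using
    integral_smoothTransition_le (volume.restrict (Set.Ioc 0 1)) g.continuous.measurable hK

theorem exists_meanZero_twoPlateau {μ₁ μ₂ δ : ℝ} (hμ₁ : 0 ≤ μ₁) (hμ₂ : 0 ≤ μ₂) (hμ : μ₁ + μ₂ = 1)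
    (hδ : 0 < δ) :
    ∃ h a₁ a₂ : PeriodicProfile, ∫ s in (0 : ℝ)..1, h s = 0 ∧ (∀ s, h s ∈ Set.Icc (-μ₂) μ₁) ∧
      ((∀ s, a₁ s ∈ Set.Icc 0 1) ∧ (∀ s, a₁ s ≠ 0 → h s = -μ₂) ∧
        μ₁ - δ < ∫ s in (0 : ℝ)..1, a₁ s) ∧
      ((∀ s, a₂ s ∈ Set.Icc 0 1) ∧ (∀ s, a₂ s ≠ 0 → h s = μ₁) ∧
        μ₂ - δ < ∫ s in (0 : ℝ)..1, a₂ s) := by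
  obtain rfl : μ₁ = 1 - μ₂ := by linarith
  have hmem : 1 - μ₂ ∈ Set.Icc 0 1 := ⟨hμ₁, by linarith⟩
  set g := cosProfile (1 - μ₂)
  have hpos : (volume.restrict (Set.Ioc 0 1)).real {s | 0 < g s} = 1 - μ₂ :=
    volume_cosProfile_pos hmem
  have hneg : (volume.restrict (Set.Ioc 0 1)).real {s | 0 < g.neg s} = μ₂ := by
    rw [volume_neg_cosProfile_pos hmem, sub_sub_cancel]
  obtain ⟨K, hK, h₁, h₂⟩ := ((eventually_ge_atTop 0).and
    ((g.eventually_lt_integral_transition ((sub_lt_self _ hδ).trans_eq hpos.symm)).and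
      (g.neg.eventually_lt_integral_transition ((sub_lt_self _ hδ).trans_eq hneg.symm)))).exists
  obtain ⟨h, hmean, hrange, hval₁, hval₂⟩ := g.exists_meanZero_of_transition K
    ((g.neg.integral_transition_le hK).trans_eq hneg) ((g.integral_transition_le hK).trans_eq hpos)
  exact ⟨h, g.transition K 1, g.neg.transition K 1, hmean, hrange,
    ⟨g.transition_mem_Icc K 1, hval₁, h₁⟩, g.neg.transition_mem_Icc K 1, hval₂, h₂⟩

end PeriodicProfile

section Symbols

variable {ι R : Type*} [Fintype ι] [DecidableEq ι] [CommRing R]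

/-- The matrix `|ξ|² I - ξ ξᵀ`, which is `|ξ|²` times the orthogonal projection along `ξ`. -/
def perpMat (ξ : ι → R) : Matrix ι ι R :=
  (ξ ⬝ᵥ ξ) • 1 - Matrix.vecMulVec ξ ξ

theorem perpMat_mulVec_self (ξ : ι → R) : perpMat ξ *ᵥ ξ = 0 := by
  simp [perpMat, Matrix.sub_mulVec, Matrix.smul_mulVec, Matrix.vecMulVec_mulVec]

theorem transpose_perpMat (ξ : ι → R) : (perpMat ξ)ᵀ = perpMat ξ := by
  simp [perpMat, Matrix.transpose_vecMulVec]

theorem perpMat_mul_self (ξ : ι → R) : perpMat ξ * perpMat ξ = (ξ ⬝ᵥ ξ) • perpMat ξ := by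
  have hξ : ξ ᵥ* perpMat ξ = 0 := by
    rw [← Matrix.mulVec_transpose, transpose_perpMat, perpMat_mulVec_self]
  conv_lhs => rw [perpMat, Matrix.sub_mul, Matrix.smul_mul, Matrix.one_mul,
    ← perpMat, Matrix.vecMulVec_mul, hξ]
  simp

theorem trace_perpMat (ξ : ι → R) : (perpMat ξ).trace = (Fintype.card ι - 1) * (ξ ⬝ᵥ ξ) := by
  simp only [perpMat, Matrix.trace_sub, Matrix.trace_smul, Matrix.trace_one, Matrix.trace_vecMulVec,
    smul_eq_mul]
  ring

theorem mul_perpMat {U : Matrix ι ι R} {ξ : ι → R} (hU : U *ᵥ ξ = 0) :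
    U * perpMat ξ = (ξ ⬝ᵥ ξ) • U := by
  simp [perpMat, Matrix.mul_sub, Matrix.mul_vecMulVec, hU]

/-- The symbol of a potential operator for divergence-free fields of symmetric trace-free matrices:
the conjugate of `U` by `perpMat ξ`, made trace-free by a multiple of `perpMat ξ`. -/
def divFreeSymbol (U : Matrix ι ι R) (ξ : ι → R) : Matrix ι ι R :=
  ((Fintype.card ι - 1 : R)) • (perpMat ξ * U * perpMat ξ) - (U * perpMat ξ).trace • perpMat ξ

theorem divFreeSymbol_mulVec_self (U : Matrix ι ι R) (ξ : ι → R) : divFreeSymbol U ξ *ᵥ ξ = 0 := by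
  simp [divFreeSymbol, Matrix.sub_mulVec, Matrix.smul_mulVec, ← Matrix.mulVec_mulVec,
    perpMat_mulVec_self]

theorem transpose_divFreeSymbol {U : Matrix ι ι R} (hU : Uᵀ = U) (ξ : ι → R) :
    (divFreeSymbol U ξ)ᵀ = divFreeSymbol U ξ := by
  simp only [divFreeSymbol, Matrix.transpose_sub, Matrix.transpose_smul, Matrix.transpose_mul,
    transpose_perpMat, hU, Matrix.mul_assoc]

theorem trace_divFreeSymbol (U : Matrix ι ι R) (ξ : ι → R) : (divFreeSymbol U ξ).trace = 0 := by
  have hconj : (perpMat ξ * U * perpMat ξ).trace = (ξ ⬝ᵥ ξ) * (U * perpMat ξ).trace := by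
    rw [Matrix.mul_assoc, Matrix.trace_mul_comm, Matrix.mul_assoc, perpMat_mul_self,
      Matrix.mul_smul, Matrix.trace_smul, smul_eq_mul]
  rw [divFreeSymbol, Matrix.trace_sub, Matrix.trace_smul, Matrix.trace_smul, hconj, trace_perpMat]
  simp only [smul_eq_mul]
  ring

theorem divFreeSymbol_of_mulVec_eq_zero {U : Matrix ι ι R} {ξ : ι → R} (hU : Uᵀ = U)
    (htrace : U.trace = 0) (hUξ : U *ᵥ ξ = 0) :
    divFreeSymbol U ξ = ((Fintype.card ι - 1) * (ξ ⬝ᵥ ξ) ^ 2) • U := by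
  have hright : U * perpMat ξ = (ξ ⬝ᵥ ξ) • U := mul_perpMat hUξ
  have hleft : perpMat ξ * U = (ξ ⬝ᵥ ξ) • U := by
    simpa only [Matrix.transpose_mul, Matrix.transpose_smul, transpose_perpMat, hU] using
      congrArg Matrix.transpose hright
  rw [divFreeSymbol, hleft, Matrix.smul_mul, hright, Matrix.trace_smul, htrace, smul_zero,
    zero_smul, sub_zero, smul_smul, smul_smul, mul_assoc, sq]

theorem map_divFreeSymbol {S : Type*} [CommRing S] (f : R →+* S) (U : Matrix ι ι R) (ξ : ι → R) :
    (divFreeSymbol U ξ).map f = divFreeSymbol (U.map f) (f ∘ ξ) := by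
  have hperp : (perpMat ξ).map f = perpMat (f ∘ ξ) := by
    ext i j
    simp [perpMat, Matrix.vecMulVec_apply, Matrix.one_apply, apply_ite f, f.map_dotProduct]
  have htrace : f (U * perpMat ξ).trace = (U.map f * perpMat (f ∘ ξ)).trace := by
    rw [← hperp, ← Matrix.map_mul]
    exact map_sum f _ _
  rw [divFreeSymbol, divFreeSymbol, ← htrace, ← hperp, ← Matrix.map_mul, ← Matrix.map_mul]
  ext i j
  simp [-Matrix.map_mul]

/-- The symbol `g ↦ N (ξ gᵀ + g ξᵀ) - 2 (ξ · g) I` of the trace-free symmetric gradient, multiplied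
by the dimension `N`. -/
def symGradSymbol (g ξ : ι → R) : Matrix ι ι R :=
  (Fintype.card ι : R) • (Matrix.vecMulVec ξ g + Matrix.vecMulVec g ξ) - (2 * (ξ ⬝ᵥ g)) • 1

theorem transpose_symGradSymbol (g ξ : ι → R) : (symGradSymbol g ξ)ᵀ = symGradSymbol g ξ := by
  simp [symGradSymbol, Matrix.transpose_vecMulVec, add_comm]

theorem trace_symGradSymbol (g ξ : ι → R) : (symGradSymbol g ξ).trace = 0 := by
  simp only [symGradSymbol, Matrix.trace_sub, Matrix.trace_smul, Matrix.trace_add,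
    Matrix.trace_vecMulVec, Matrix.trace_one, smul_eq_mul, dotProduct_comm g ξ]
  ring

/-- The vector `g` for which `symGradSymbol g ξ` sends `ξ` to a multiple of `b`. -/
def symGradPotential (b ξ : ι → R) : ι → R :=
  (2 * (Fintype.card ι - 1) * (ξ ⬝ᵥ ξ)) • b - ((Fintype.card ι - 2) * (ξ ⬝ᵥ b)) • ξ

theorem symGradSymbol_symGradPotential_mulVec_self (b ξ : ι → R) :
    symGradSymbol (symGradPotential b ξ) ξ *ᵥ ξ =
      (2 * Fintype.card ι * (Fintype.card ι - 1) * (ξ ⬝ᵥ ξ) ^ 2) • b := by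
  ext i
  simp only [symGradSymbol, symGradPotential, Matrix.sub_mulVec, Matrix.add_mulVec,
    Matrix.smul_mulVec, Matrix.one_mulVec, Matrix.vecMulVec_mulVec, sub_dotProduct, dotProduct_sub,
    smul_dotProduct, dotProduct_smul, Pi.sub_apply, Pi.add_apply, Pi.smul_apply, smul_eq_mul,
    op_smul_eq_smul, dotProduct_comm b ξ]
  ring

end Symbols

section Homogeneous

open MvPolynomial

section

variable {σ R : Type*} [CommRing R]

theorem isHomogeneous_natCast (k : ℕ) : (k : MvPolynomial σ R).IsHomogeneous 0 :=
  map_natCast (C : R →+* MvPolynomial σ R) k ▸ isHomogeneous_C _ _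

theorem isHomogeneous_one_apply {ι : Type*} [DecidableEq ι] (i j : ι) :
    ((1 : Matrix ι ι (MvPolynomial σ R)) i j).IsHomogeneous 0 := by
  rw [Matrix.one_apply]
  split_ifs
  · exact isHomogeneous_one _ _
  · exact isHomogeneous_zero _ _ _

variable {ι : Type*} [Fintype ι] {a b : ℕ}

theorem isHomogeneous_dotProduct {v w : ι → MvPolynomial σ R} (hv : ∀ i, (v i).IsHomogeneous a)
    (hw : ∀ i, (w i).IsHomogeneous b) : (v ⬝ᵥ w).IsHomogeneous (a + b) :=
  IsHomogeneous.sum _ _ _ fun i _ => (hv i).mul (hw i)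

theorem isHomogeneous_matrix_mul {M N : Matrix ι ι (MvPolynomial σ R)}
    (hM : ∀ i j, (M i j).IsHomogeneous a) (hN : ∀ i j, (N i j).IsHomogeneous b) (i j : ι) :
    ((M * N) i j).IsHomogeneous (a + b) :=
  IsHomogeneous.sum _ _ _ fun k _ => (hM i k).mul (hN k j)

theorem isHomogeneous_trace {M : Matrix ι ι (MvPolynomial σ R)}
    (hM : ∀ i j, (M i j).IsHomogeneous a) : M.trace.IsHomogeneous a :=
  IsHomogeneous.sum _ _ _ fun k _ => hM k k

end

variable {ι R : Type*} [Fintype ι] [CommRing R] {a : ℕ}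

theorem isHomogeneous_X_dotProduct_X : ((X : ι → MvPolynomial ι R) ⬝ᵥ X).IsHomogeneous 2 :=
  isHomogeneous_dotProduct (isHomogeneous_X R) (isHomogeneous_X R)

theorem isHomogeneous_symGradPotential {v : ι → MvPolynomial ι R}
    (hv : ∀ i, (v i).IsHomogeneous a) (i : ι) : (symGradPotential v X i).IsHomogeneous (a + 2) := by
  have hcard (k : ℕ) : ((Fintype.card ι - k : MvPolynomial ι R)).IsHomogeneous 0 :=
    (isHomogeneous_natCast _).sub (isHomogeneous_natCast _)
  have hmain := (((isHomogeneous_natCast 2).mul (hcard 1)).mul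
    isHomogeneous_X_dotProduct_X).mul (hv i)
  have hcorrection := ((hcard 2).mul (isHomogeneous_dotProduct (isHomogeneous_X R) hv)).mul
    (isHomogeneous_X R i)
  have hdegree : 0 + 0 + 2 + a = a + 2 := by ring
  have hdegree' : 0 + (1 + a) + 1 = a + 2 := by ring
  rw [hdegree] at hmain
  rw [hdegree'] at hcorrection
  simpa only [Nat.cast_one, Nat.cast_ofNat] using! hmain.sub hcorrection

variable [DecidableEq ι]

theorem isHomogeneous_perpMat (i j : ι) :
    (perpMat (X : ι → MvPolynomial ι R) i j).IsHomogeneous 2 :=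
  (isHomogeneous_X_dotProduct_X.mul (isHomogeneous_one_apply i j)).sub
    ((isHomogeneous_X R i).mul (isHomogeneous_X R j))

theorem isHomogeneous_divFreeSymbol {U : Matrix ι ι (MvPolynomial ι R)}
    (hU : ∀ i j, (U i j).IsHomogeneous a) (i j : ι) :
    (divFreeSymbol U X i j).IsHomogeneous (a + 4) := by
  have hdegree : 0 + (2 + a + 2) = a + 4 := by ring
  have hcard : ((Fintype.card ι - 1 : MvPolynomial ι R)).IsHomogeneous 0 :=
    (isHomogeneous_natCast _).sub (isHomogeneous_one _ _)
  have hconj := hcard.mul (isHomogeneous_matrix_mul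
    (isHomogeneous_matrix_mul isHomogeneous_perpMat hU) isHomogeneous_perpMat i j)
  exact (hdegree ▸ hconj).sub
    ((isHomogeneous_trace (isHomogeneous_matrix_mul hU isHomogeneous_perpMat)).mul
      (isHomogeneous_perpMat i j))

theorem isHomogeneous_symGradSymbol {g : ι → MvPolynomial ι R}
    (hg : ∀ i, (g i).IsHomogeneous a) (i j : ι) :
    (symGradSymbol g X i j).IsHomogeneous (a + 1) := by
  have hleft : (X i * g j).IsHomogeneous (a + 1) :=
    add_comm 1 a ▸ (isHomogeneous_X R i).mul (hg j)
  have hgrad := (isHomogeneous_natCast (Fintype.card ι)).mul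
    (hleft.add ((hg i).mul (isHomogeneous_X R j)))
  have hdiv := ((isHomogeneous_natCast 2).mul
    (isHomogeneous_dotProduct (isHomogeneous_X R) hg)).mul (isHomogeneous_one_apply i j)
  have hdegree : 0 + (1 + a) + 0 = 0 + (a + 1) := by ring
  exact zero_add (a + 1) ▸ hgrad.sub (hdegree ▸ hdiv)

end Homogeneous

section PotentialSymbol

open MvPolynomial

theorem constantCoeff_of_isHomogeneous {σ : Type*} {p : MvPolynomial σ ℝ} {k : ℕ}
    (hp : p.IsHomogeneous (k + 1)) : constantCoeff p = 0 := by
  rw [constantCoeff_eq]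
  exact hp.coeff_eq_zero (by simp)

variable {ι : Type*} [Fintype ι]

/-- The symbols of a potential operator for the system `∇ · m = 0`, `∇ · V = B m` in a vector field
`m` and a field `V` of symmetric trace-free matrices: the variable `X j` stands for `∂ⱼ`. The
vanishing constant coefficients make every field in the range of the operator an exact
derivative. -/
structure PotentialSymbol (B : Matrix ι ι ℝ) where
  vec : ι → MvPolynomial ι ℝ
  mat : Matrix ι ι (MvPolynomial ι ℝ)
  transpose_mat : matᵀ = mat
  trace_mat : mat.trace = 0
  vec_dotProduct_X : vec ⬝ᵥ X = 0
  mat_mulVec_X : mat *ᵥ X = B.map C *ᵥ vec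
  constantCoeff_vec (i : ι) : constantCoeff (vec i) = 0
  constantCoeff_mat (i j : ι) : constantCoeff (mat i j) = 0

/-- The vector symbol `(η · ξ) m - (m · ξ) η`, orthogonal to `ξ` and equal to `|η|² m` at `ξ = η`
when `m` is orthogonal to `η`. -/
noncomputable def perpSymbol (η m : ι → ℝ) : ι → MvPolynomial ι ℝ :=
  ((C ∘ η) ⬝ᵥ X) • (C ∘ m) - ((C ∘ m) ⬝ᵥ X) • (C ∘ η)

theorem perpSymbol_dotProduct_X (η m : ι → ℝ) : perpSymbol η m ⬝ᵥ X = 0 := by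
  simp only [perpSymbol, sub_dotProduct, smul_dotProduct, smul_eq_mul]
  ring

theorem isHomogeneous_perpSymbol (η m : ι → ℝ) (i : ι) : (perpSymbol η m i).IsHomogeneous 1 := by
  have hlinear (v : ι → ℝ) : ((C ∘ v) ⬝ᵥ X : MvPolynomial ι ℝ).IsHomogeneous (0 + 1) :=
    isHomogeneous_dotProduct (fun i => isHomogeneous_C _ (v i)) (isHomogeneous_X ℝ)
  exact ((hlinear η).mul (isHomogeneous_C _ (m i))).sub
    ((hlinear m).mul (isHomogeneous_C _ (η i)))

theorem eval_C_comp_dotProduct_X (η v : ι → ℝ) : eval η ((C ∘ v) ⬝ᵥ X) = v ⬝ᵥ η := by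
  simp [dotProduct]

theorem eval_perpSymbol {η m : ι → ℝ} (hm : m ⬝ᵥ η = 0) (i : ι) :
    eval η (perpSymbol η m i) = (η ⬝ᵥ η) * m i := by
  simp [perpSymbol, eval_C_comp_dotProduct_X, hm]

variable [DecidableEq ι]

theorem isHomogeneous_sourceSymbol (B : Matrix ι ι ℝ) (η m : ι → ℝ) (i j : ι) :
    (symGradSymbol (symGradPotential (B.map C *ᵥ perpSymbol η m) X) X i j).IsHomogeneous 4 :=
  isHomogeneous_symGradSymbol (isHomogeneous_symGradPotential fun i =>
    isHomogeneous_dotProduct (fun j => isHomogeneous_C _ (B i j))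
      (isHomogeneous_perpSymbol η m)) i j

theorem isHomogeneous_waveSymbol (η : ι → ℝ) (U : Matrix ι ι ℝ) (i j : ι) :
    (2 * Fintype.card ι * ((C ∘ η) ⬝ᵥ (X : ι → MvPolynomial ι ℝ)) *
      divFreeSymbol (U.map C) X i j).IsHomogeneous 5 :=
  ((((isHomogeneous_natCast 2).mul (isHomogeneous_natCast _)).mul
    (isHomogeneous_dotProduct (fun i => isHomogeneous_C _ (η i)) (isHomogeneous_X ℝ))).mul
    (isHomogeneous_divFreeSymbol (fun i j => isHomogeneous_C _ (U i j)) i j))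

/-- The potential operator of order five whose leading part at `η` is a multiple of `(m, U)` when
`m · η = 0` and `U η = 0`. The second summand of the matrix symbol, of order four only, produces the
source term `B m`. -/
noncomputable def wavePotential (B : Matrix ι ι ℝ) (η m : ι → ℝ) {U : Matrix ι ι ℝ} (hU : Uᵀ = U) :
    PotentialSymbol B where
  vec := (2 * Fintype.card ι * (Fintype.card ι - 1) * ((X : ι → MvPolynomial ι ℝ) ⬝ᵥ X) ^ 2) •
    perpSymbol η m
  mat := (2 * Fintype.card ι * ((C ∘ η) ⬝ᵥ (X : ι → MvPolynomial ι ℝ))) •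
    divFreeSymbol (U.map C) X +
    symGradSymbol (symGradPotential (B.map C *ᵥ perpSymbol η m) X) X
  transpose_mat := by
    rw [Matrix.transpose_add, Matrix.transpose_smul, transpose_symGradSymbol,
      transpose_divFreeSymbol (by rw [← Matrix.transpose_map, hU])]
  trace_mat := by
    rw [Matrix.trace_add, Matrix.trace_smul, trace_divFreeSymbol, trace_symGradSymbol, smul_zero,
      add_zero]
  vec_dotProduct_X := by rw [smul_dotProduct, perpSymbol_dotProduct_X, smul_zero]
  mat_mulVec_X := by
    rw [Matrix.add_mulVec, Matrix.smul_mulVec, divFreeSymbol_mulVec_self,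
      symGradSymbol_symGradPotential_mulVec_self, Matrix.mulVec_smul, smul_zero, zero_add]
  constantCoeff_vec i := by
    rw [Pi.smul_apply, smul_eq_mul, map_mul,
      constantCoeff_of_isHomogeneous (isHomogeneous_perpSymbol η m i), mul_zero]
  constantCoeff_mat i j := by
    rw [Matrix.add_apply, map_add, Matrix.smul_apply, smul_eq_mul,
      constantCoeff_of_isHomogeneous (isHomogeneous_waveSymbol η U i j),
      constantCoeff_of_isHomogeneous (isHomogeneous_sourceSymbol B η m i j), add_zero]

variable {E F : Type*} [NormedAddCommGroup E] [NormedSpace ℝ E] [NormedAddCommGroup F]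
  [NormedSpace ℝ F] (Ω : Opens E) (e : ι → E) {L : E →L[ℝ] ℝ} (B : Matrix ι ι ℝ) {η m : ι → ℝ}
  {U : Matrix ι ι ℝ} (hU : Uᵀ = U)

theorem hasPrincipalValue_wavePotential_vec (hη : ∀ j, L (e j) = η j) (hm : m ⬝ᵥ η = 0) (i : ι) :
    HasPrincipalValue F Ω e L 5 ((wavePotential B η m hU).vec i)
      (2 * Fintype.card ι * (Fintype.card ι - 1) * (η ⬝ᵥ η) ^ 3 * m i) := by
  have hhom : ((wavePotential B η m hU).vec i).IsHomogeneous 5 :=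
    ((((isHomogeneous_natCast 2).mul (isHomogeneous_natCast _)).mul
      ((isHomogeneous_natCast _).sub (isHomogeneous_one _ _))).mul
      (isHomogeneous_X_dotProduct_X.pow 2)).mul (isHomogeneous_perpSymbol η m i)
  convert hasPrincipalValue_of_isHomogeneous hhom Ω e L using 1
  have hnorm : eval η (X ⬝ᵥ X) = η ⬝ᵥ η := by simp [dotProduct]
  simp only [hη, wavePotential, Pi.smul_apply, smul_eq_mul, map_mul, map_sub, map_pow, map_one,
    map_ofNat, map_natCast, hnorm, eval_perpSymbol hm]
  ring

theorem hasPrincipalValue_wavePotential_mat (hη : ∀ j, L (e j) = η j) (htrace : U.trace = 0)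
    (hUη : U *ᵥ η = 0) (i j : ι) :
    HasPrincipalValue F Ω e L 5 ((wavePotential B η m hU).mat i j)
      (2 * Fintype.card ι * (Fintype.card ι - 1) * (η ⬝ᵥ η) ^ 3 * U i j) := by
  have hwave := hasPrincipalValue_of_isHomogeneous (F := F)
    (isHomogeneous_waveSymbol η U i j) Ω e L
  have hsource := (hasPrincipalValue_of_isHomogeneous (F := F)
    (isHomogeneous_sourceSymbol B η m i j) Ω e L).succ
  have hsymbol : eval η (divFreeSymbol (U.map C) X i j) =
      (Fintype.card ι - 1) * (η ⬝ᵥ η) ^ 2 * U i j := by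
    have hmap := map_divFreeSymbol (eval η) (U.map C) X
    rw [Matrix.map_map, show eval η ∘ C = id from funext fun _ => eval_C _, Matrix.map_id,
      show eval η ∘ X = η from funext fun _ => eval_X _,
      divFreeSymbol_of_mulVec_eq_zero hU htrace hUη] at hmap
    exact congr($hmap i j)
  have hvalue : eval (fun j => L (e j)) (2 * Fintype.card ι * ((C ∘ η) ⬝ᵥ X) *
      divFreeSymbol (U.map C) X i j) + 0 =
        2 * Fintype.card ι * (Fintype.card ι - 1) * (η ⬝ᵥ η) ^ 3 * U i j := by
    simp only [hη, map_mul, map_ofNat, map_natCast, eval_C_comp_dotProduct_X, hsymbol]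
    ring
  exact hvalue ▸ hwave.add hsource

end PotentialSymbol

section StateField

open MvPolynomial

variable {n : ℕ}

theorem State.transpose_mat (z : State n) : z.matᵀ = z.mat := z.snd.2.1

theorem State.trace_mat (z : State n) : z.mat.trace = 0 := z.snd.2.2

/-- The entries of the vector and of the matrix of a state. -/
def State.components (z : State n) : Fin n ⊕ Fin n × Fin n → ℝ :=
  Sum.elim z.vec fun p => z.mat p.1 p.2

/-- The state with the given components. The matrix is projected onto the symmetric trace-free ones,
so that every family of numbers is allowed. -/
noncomputable def State.ofComponents : (Fin n ⊕ Fin n × Fin n → ℝ) →L[ℝ] State n :=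
  ((WithLp.prodContinuousLinearEquiv 2 ℝ (EuclideanSpace ℝ (Fin n)) (SymTraceless n)).symm :
      EuclideanSpace ℝ (Fin n) × SymTraceless n →L[ℝ] State n) ∘L
    (((EuclideanSpace.equiv (Fin n) ℝ).symm : (Fin n → ℝ) →L[ℝ] EuclideanSpace ℝ (Fin n)) ∘L
      .pi fun i => .proj (.inl i)).prod
    ((SymTraceless n).orthogonalProjectionOnto ∘L
      ((EuclideanSpace.equiv (Fin n × Fin n) ℝ).symm :
        (Fin n × Fin n → ℝ) →L[ℝ] EuclideanSpace ℝ (Fin n × Fin n)) ∘L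
      .pi fun p => .proj (.inr p))

theorem State.vec_ofComponents (c : Fin n ⊕ Fin n × Fin n → ℝ) (i : Fin n) :
    (ofComponents c).vec i = c (.inl i) := rfl

theorem State.mat_ofComponents {c : Fin n ⊕ Fin n × Fin n → ℝ} {M : Matrix (Fin n) (Fin n) ℝ}
    (hc : ∀ i j, c (.inr (i, j)) = M i j) (hM : Mᵀ = M) (htrace : M.trace = 0) :
    (ofComponents c).mat = M := by
  have hmat : toMat (WithLp.toLp 2 fun p => c (.inr p)) = M := Matrix.ext hc
  have hmem : (WithLp.toLp 2 fun p => c (.inr p)) ∈ SymTraceless n :=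
    ⟨by rw [hmat, hM], by rw [hmat, htrace]⟩
  exact (congrArg toMat (Submodule.starProjection_eq_self_iff.2 hmem)).trans hmat

theorem State.ofComponents_components (z : State n) : ofComponents z.components = z := by
  have hmat : (ofComponents z.components).mat = z.mat :=
    mat_ofComponents (fun _ _ => rfl) z.transpose_mat z.trace_mat
  refine WithLp.ofLp_injective 2 (Prod.ext rfl (Subtype.ext (PiLp.ext fun p => ?_)))
  exact congrFun (congrFun hmat p.1) p.2

namespace PotentialSymbol

variable {B : Matrix (Fin n) (Fin n) ℝ} (P : PotentialSymbol B)
  {Ω : Opens (EuclideanSpace ℝ (Fin n))} (φ : 𝓓(Ω, ℝ)) (x : EuclideanSpace ℝ (Fin n))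

/-- The symbols of all components of the potential operator. -/
def components : Fin n ⊕ Fin n × Fin n → MvPolynomial (Fin n) ℝ :=
  Sum.elim P.vec fun p => P.mat p.1 p.2

/-- The potential operator, acting on scalar test functions. -/
noncomputable def field : 𝓓(Ω, ℝ) →ₗ[ℝ] 𝓓(Ω, State n) :=
  ∑ k, (TestFunction.postcompCLM (𝕜 := ℝ) (Ω := Ω) (n := ⊤)
    (ContinuousLinearMap.toSpanSingleton ℝ (State.ofComponents (Pi.single k 1)) :
      ℝ →L[ℝ] State n)).toLinearMap ∘ₗ
    diffOp (EuclideanSpace.basisFun (Fin n) ℝ) (P.components k)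

theorem field_apply : P.field φ x = State.ofComponents fun k =>
    diffOp (EuclideanSpace.basisFun (Fin n) ℝ) (P.components k) φ x := by
  have hpi (c : Fin n ⊕ Fin n × Fin n → ℝ) := pi_eq_sum_univ' c
  rw [field, hpi fun k => _, map_sum]
  simp [TestFunction.postcompCLM_apply]

theorem vec_field (i : Fin n) : (P.field φ x).vec i =
    diffOp (EuclideanSpace.basisFun (Fin n) ℝ) (P.vec i) φ x := by
  rw [field_apply, State.vec_ofComponents]
  rfl

theorem mat_field (i j : Fin n) : (P.field φ x).mat i j =
    diffOp (EuclideanSpace.basisFun (Fin n) ℝ) (P.mat i j) φ x := by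
  set M := Matrix.of fun i j => diffOp (EuclideanSpace.basisFun (Fin n) ℝ) (P.mat i j) φ x
  have hM : Mᵀ = M := Matrix.ext fun i j =>
    congr(diffOp (EuclideanSpace.basisFun (Fin n) ℝ) ($P.transpose_mat i j) φ x)
  have htrace : M.trace = 0 := by
    have h := congr(diffOp (EuclideanSpace.basisFun (Fin n) ℝ) $P.trace_mat φ x)
    simpa only [M, Matrix.trace, Matrix.diag_apply, Matrix.of_apply, map_sum,
      LinearMap.sum_apply, sum_apply, map_zero, LinearMap.zero_apply, zero_apply] using h
  rw [field_apply, State.mat_ofComponents (M := M) (fun _ _ => rfl) hM htrace]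
  rfl

theorem divVec_field : divVec (fun y => (P.field φ y).vec) x = 0 := by
  have h := congr($(sum_lineDerivOp_diffOp (EuclideanSpace.basisFun (Fin n) ℝ) φ P.vec) x)
  simpa only [divVec, partialD, vec_field, P.vec_dotProduct_X, sum_apply, lineDerivOp_apply,
    EuclideanSpace.basisFun_apply, map_zero, LinearMap.zero_apply, zero_apply] using h

theorem divMat_field :
    divMat (fun y => (P.field φ y).mat) x = B *ᵥ (P.field φ x).vec.ofLp := by
  ext i
  have h := congr($(sum_lineDerivOp_diffOp (EuclideanSpace.basisFun (Fin n) ℝ) φ (P.mat i)) x)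
  have hi : P.mat i ⬝ᵥ X = ∑ j, C (B i j) * P.vec j := congrFun P.mat_mulVec_X i
  simp only [hi, map_sum, map_mul] at h
  simpa [divMat, partialD, mat_field, vec_field, lineDerivOp_apply, Matrix.mulVec, dotProduct,
    diffOp_C] using h

theorem integral_field : ∫ x, P.field φ x = 0 := by
  have hzero (k) : constantCoeff (P.components k) = 0 := by
    rcases k with i | ⟨i, j⟩
    exacts [P.constantCoeff_vec i, P.constantCoeff_mat i j]
  have hint (k) := integrable_testFunction volume
    (diffOp (EuclideanSpace.basisFun (Fin n) ℝ) (P.components k) φ)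
  have hcomponents : ∫ x, (fun k => diffOp (EuclideanSpace.basisFun (Fin n) ℝ) (P.components k) φ x)
      = 0 := by
    ext k
    rw [eval_integral hint, integral_diffOp, hzero, zero_smul, Pi.zero_apply]
  simp only [field_apply]
  rw [ContinuousLinearMap.integral_comp_comm _ (.of_eval hint), hcomponents, map_zero]

end PotentialSymbol

end StateField

section Oscillation

variable {n : ℕ}

theorem eq_zero_of_mem_waveCone [Subsingleton (Fin n)] {z : State n} (hz : z ∈ waveCone n) :
    z = 0 := by
  obtain ⟨η, hη, hvec, -⟩ := hz
  have hcomponents : z.components = 0 := by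
    ext k
    rcases k with i | ⟨i, j⟩
    · have hηi : η i ≠ 0 := fun h => hη (PiLp.ext fun j => Subsingleton.elim i j ▸ h)
      rw [PiLp.inner_apply, Fintype.sum_subsingleton _ i] at hvec
      simpa [State.components, hηi] using hvec
    · have htrace := z.trace_mat
      rw [Matrix.trace, Fintype.sum_subsingleton _ i] at htrace
      exact Subsingleton.elim i j ▸ htrace
  rw [← z.ofComponents_components, hcomponents, map_zero]

variable {Ω : Opens (EuclideanSpace ℝ (Fin n))}

theorem PotentialSymbol.tendsto_field {B : Matrix (Fin n) (Fin n) ℝ} {P : PotentialSymbol B}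
    {L : EuclideanSpace ℝ (Fin n) →L[ℝ] ℝ} {k : ℕ} {c : ℝ} {z : State n}
    (h : ∀ i, HasPrincipalValue ℝ Ω (EuclideanSpace.basisFun (Fin n) ℝ) L k (P.components i)
      (c * z.components i)) (G : PeriodicProfile) (χ : 𝓓(Ω, ℝ)) :
    Tendsto (fun q : ℝ × EuclideanSpace ℝ (Fin n) =>
      (q.1 ^ k)⁻¹ • P.field (planeWave L G χ q.1) q.2 -
        c • planeWave L (PeriodicProfile.deriv^[k] G) χ q.1 q.2 • z) (atTop ×ˢ ⊤) (𝓝 0) := by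
  have hcomponents := tendsto_pi_nhds.2 fun i => h i G χ
  have hstate := (State.ofComponents (n := n).continuous.tendsto 0).comp hcomponents
  rw [map_zero] at hstate
  refine hstate.congr fun q => ?_
  set a := planeWave L (PeriodicProfile.deriv^[k] G) χ q.1 q.2
  have hsplit : (fun i => (q.1 ^ k)⁻¹ • diffOp (EuclideanSpace.basisFun (Fin n) ℝ)
      (P.components i) (planeWave L G χ q.1) q.2 - (c * z.components i) • a) =
      (q.1 ^ k)⁻¹ • (fun i => diffOp (EuclideanSpace.basisFun (Fin n) ℝ)
        (P.components i) (planeWave L G χ q.1) q.2) - c • a • z.components := by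
    ext i
    simp only [Pi.sub_apply, Pi.smul_apply, smul_eq_mul]
    ring
  rw [Function.comp_apply, hsplit, map_sub, map_smul, map_smul, map_smul,
    z.ofComponents_components, field_apply]

theorem exists_tendsto_field_sub_planeWave_smul (B : Matrix (Fin n) (Fin n) ℝ) {z : State n}
    (hz : z ∈ waveCone n) (Ω : Opens (EuclideanSpace ℝ (Fin n))) :
    ∃ L : EuclideanSpace ℝ (Fin n) →L[ℝ] ℝ, L ≠ 0 ∧
      ∀ (h : PeriodicProfile) (_ : ∫ s in (0 : ℝ)..1, h s = 0) (χ : 𝓓(Ω, ℝ)),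
      ∃ (P : PotentialSymbol B) (φ : ℝ → 𝓓(Ω, ℝ)),
        Tendsto (fun q : ℝ × EuclideanSpace ℝ (Fin n) =>
          P.field (φ q.1) q.2 - planeWave L h χ q.1 q.2 • z) (atTop ×ˢ ⊤) (𝓝 0) := by
  have ⟨η, hη, hm, hU⟩ := hz
  refine ⟨innerSL ℝ η, by rwa [ne_eq, ← norm_eq_zero, innerSL_apply_norm, norm_eq_zero],
    fun h hh χ => ?_⟩
  obtain ⟨A, rfl⟩ := PeriodicProfile.exists_iterate_deriv_eq hh 5
  set P := wavePotential B η z.vec z.transpose_mat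
  rcases subsingleton_or_nontrivial (Fin n) with _ | _
  · refine ⟨P, 0, ?_⟩
    simp [eq_zero_of_mem_waveCone hz]
  have hL (j : Fin n) : innerSL ℝ η (EuclideanSpace.basisFun (Fin n) ℝ j) = η j := by
    simp [EuclideanSpace.inner_single_right]
  have hm' : z.vec.ofLp ⬝ᵥ η.ofLp = 0 := by
    simpa [PiLp.inner_apply, dotProduct, mul_comm] using hm
  set c : ℝ := 2 * Fintype.card (Fin n) * (Fintype.card (Fin n) - 1) * (η.ofLp ⬝ᵥ η.ofLp) ^ 3
  have hc : c ≠ 0 := by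
    have hcard : (1 : ℝ) < Fintype.card (Fin n) := by exact_mod_cast Fintype.one_lt_card
    have hη' : η.ofLp ⬝ᵥ η.ofLp ≠ 0 := by simpa [dotProduct_self_eq_zero] using hη
    exact mul_ne_zero (mul_ne_zero (by positivity) (sub_ne_zero.2 hcard.ne')) (pow_ne_zero _ hη')
  have hprincipal (i) : HasPrincipalValue ℝ Ω (EuclideanSpace.basisFun (Fin n) ℝ) (innerSL ℝ η) 5
      (P.components i) (c * z.components i) := by
    rcases i with i | ⟨i, j⟩
    · exact hasPrincipalValue_wavePotential_vec Ω _ B z.transpose_mat hL hm' i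
    · exact hasPrincipalValue_wavePotential_mat Ω _ B z.transpose_mat hL z.trace_mat hU i j
  have hlim := (P.tendsto_field hprincipal A χ).const_smul c⁻¹
  rw [smul_zero] at hlim
  refine ⟨P, fun N => c⁻¹ • (N ^ 5)⁻¹ • planeWave (innerSL ℝ η) A χ N, hlim.congr fun q => ?_⟩
  simp only [map_smul, smul_apply, smul_sub, inv_smul_smul₀ hc]

end Oscillation

section Cutoff

variable {E : Type*} [NormedAddCommGroup E] [NormedSpace ℝ E] {Ω : Opens E}

theorem exists_testFunction_eq_one_on [FiniteDimensional ℝ E] {K : Set E} (hK : IsCompact K)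
    (hKΩ : K ⊆ Ω) :
    ∃ χ : 𝓓(Ω, ℝ), (∀ x, χ x ∈ Set.Icc 0 1) ∧ ∀ x ∈ K, χ x = 1 := by
  obtain ⟨L, hL, hKL, hLΩ⟩ := exists_compact_between hK Ω.isOpen hKΩ
  obtain ⟨χ, hone, hzero, hrange⟩ := exists_contMDiffMap_one_nhds_of_subset_interior
    (n := (⊤ : ℕ∞)) (modelWithCornersSelf ℝ E) hK.isClosed hKL
  have htsupport : tsupport χ ⊆ L := closure_minimal
    (Function.support_subset_iff'.2 hzero) hL.isClosed
  exact ⟨⟨χ, χ.contMDiff.contDiff, hL.of_isClosed_subset (isClosed_tsupport _) htsupport,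
    htsupport.trans hLΩ⟩, hrange, fun x hx => hone.self_of_nhdsSet x hx⟩

variable [MeasurableSpace E] (ν : Measure E)

theorem integral_testFunction_le_measureReal {f : 𝓓(Ω, ℝ)} (hf : ∀ x, f x ≤ 1) {s : Set E}
    (hs : ν s ≠ ⊤) (hfs : Function.support f ⊆ s) : ∫ x, f x ∂ν ≤ ν.real s :=
  (ENNReal.ofReal_le_iff_le_toReal hs).1 <| integral_le_measure (fun x _ => hf x)
    fun _ hx => (Function.support_subset_iff'.1 hfs _ hx).le

variable [FiniteDimensional ℝ E] [BorelSpace E]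

theorem exists_testFunction_measureReal_lt_integral_add [IsFiniteMeasureOnCompacts ν]
    (hΩ : ν Ω ≠ ⊤) {δ : ℝ} (hδ : 0 < δ) :
    ∃ f : 𝓓(Ω, ℝ), (∀ x, f x ∈ Set.Icc 0 1) ∧ ν.real Ω < (∫ x, f x ∂ν) + δ := by
  obtain ⟨K, hKΩ, hK, hKδ⟩ := Ω.isOpen.measurableSet.exists_isCompact_lt_add hΩ
    (ENNReal.ofReal_pos.2 hδ).ne'
  obtain ⟨f, hf, hfK⟩ := exists_testFunction_eq_one_on hK hKΩ
  refine ⟨f, hf, ENNReal.toReal_lt_of_lt_ofReal ?_⟩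
  rw [ENNReal.ofReal_add (integral_nonneg fun x => (hf x).1) hδ.le]
  exact hKδ.trans_le (add_le_add_left ((integrable_testFunction ν f).measure_le_integral
    (.of_forall fun x => (hf x).1) fun x hx => (hfK x hx).ge) _)

variable [ν.IsAddHaarMeasure] {L : E →L[ℝ] ℝ}

theorem eventually_lt_measureReal_support_planeWave (hL : L ≠ 0) {a : PeriodicProfile}
    (ha : ∀ s, a s ∈ Set.Icc 0 1) {f : 𝓓(Ω, ℝ)} (hf : ∀ x, f x ∈ Set.Icc 0 1) {c : ℝ}
    (hc : c < (∫ s in (0 : ℝ)..1, a s) * ∫ x, f x ∂ν) :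
    ∀ᶠ N in atTop, c < ν.real (Function.support (planeWave L a f N)) := by
  filter_upwards [(tendsto_integral_planeWave ν hL a f).eventually (lt_mem_nhds hc)] with N hN
  refine hN.trans_le (integral_testFunction_le_measureReal ν (fun x => ?_) ?_ subset_rfl)
  · exact mul_le_one₀ (ha _).2 (hf x).1 (hf x).2
  · exact ((measure_mono subset_closure).trans_lt
      (planeWave L a f N).hasCompactSupport.isCompact.measure_lt_top).ne

theorem PeriodicProfile.integral_mem_Icc {a : PeriodicProfile} (ha : ∀ s, a s ∈ Set.Icc 0 1) :
    ∫ s in (0 : ℝ)..1, a s ∈ Set.Icc (0 : ℝ) 1 := by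
  refine ⟨intervalIntegral.integral_nonneg zero_le_one fun s _ => (ha s).1, ?_⟩
  simpa using intervalIntegral.integral_mono_on (μ := volume) zero_le_one
    (a.continuous.intervalIntegrable 0 1) intervalIntegrable_const fun s _ => (ha s).2

theorem mul_mem_Icc_neg {a b s t : ℝ} (ha : 0 ≤ a) (hb : 0 ≤ b) (hs : s ∈ Set.Icc (-b) a)
    (ht : t ∈ Set.Icc 0 1) : s * t ∈ Set.Icc (-b) a := by
  simpa [mul_comm s] using (convex_Icc (-b) a).smul_mem_of_zero_mem ⟨neg_nonpos.2 hb, ha⟩ hs ht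

theorem abs_sub_mul_lt_of_add_le {μ₁ μ₂ v v₁ v₂ ε : ℝ} (hμ : μ₁ + μ₂ = 1)
    (h₁ : μ₁ * v - ε < v₁) (h₂ : μ₂ * v - ε < v₂) (hv : v₁ + v₂ ≤ v) :
    |v₁ - μ₁ * v| < ε ∧ |v₂ - μ₂ * v| < ε := by
  have hsplit : μ₁ * v + μ₂ * v = v := by rw [← add_mul, hμ, one_mul]
  constructor <;> rw [abs_lt] <;> constructor <;> linarith

theorem exists_planeWave_twoPlateau (hΩ : ν Ω ≠ ⊤) (hL : L ≠ 0) {μ₁ μ₂ ε : ℝ} (hμ₁ : 0 ≤ μ₁)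
    (hμ₂ : 0 ≤ μ₂) (hμ : μ₁ + μ₂ = 1) (hε : 0 < ε) :
    ∃ (h : PeriodicProfile) (χ : 𝓓(Ω, ℝ)), ∫ s in (0 : ℝ)..1, h s = 0 ∧
      (∀ N x, planeWave L h χ N x ∈ Set.Icc (-μ₂) μ₁) ∧
      ∀ᶠ N in atTop, ∃ O₁ O₂ : Opens E, O₁ ≤ Ω ∧ O₂ ≤ Ω ∧ Disjoint (O₁ : Set E) O₂ ∧
        (∀ x ∈ O₁, planeWave L h χ N x = -μ₂) ∧ (∀ x ∈ O₂, planeWave L h χ N x = μ₁) ∧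
        |ν.real O₁ - μ₁ * ν.real Ω| < ε ∧ |ν.real O₂ - μ₂ * ν.real Ω| < ε := by
  obtain ⟨δ, hδ, hδε⟩ := exists_pos_mul_lt hε (ν.real Ω + 1)
  obtain ⟨h, a₁, a₂, hmean, hrange, ⟨ha₁, hval₁, hint₁⟩, ha₂, hval₂, hint₂⟩ :=
    PeriodicProfile.exists_meanZero_twoPlateau hμ₁ hμ₂ hμ hδ
  obtain ⟨f, hf, hfδ⟩ := exists_testFunction_measureReal_lt_integral_add ν hΩ hδ
  obtain ⟨χ, hχ, hχf⟩ := exists_testFunction_eq_one_on f.hasCompactSupport f.tsupport_subset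
  have large {a : PeriodicProfile} (ha : ∀ s, a s ∈ Set.Icc 0 1) {m : ℝ}
      (hm : m - δ < ∫ s in (0 : ℝ)..1, a s) : m * ν.real Ω - ε <
        (∫ s in (0 : ℝ)..1, a s) * ∫ x, f x ∂ν := by
    obtain ⟨h₀, h₁⟩ := PeriodicProfile.integral_mem_Icc ha
    nlinarith [measureReal_nonneg (μ := ν) (s := Ω)]
  refine ⟨h, χ, hmean, fun N x => mul_mem_Icc_neg hμ₁ hμ₂ (hrange _) (hχ x), ?_⟩
  filter_upwards [eventually_lt_measureReal_support_planeWave ν hL ha₁ hf (large ha₁ hint₁),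
    eventually_lt_measureReal_support_planeWave ν hL ha₂ hf (large ha₂ hint₂)] with N hN₁ hN₂
  let O (a : PeriodicProfile) : Opens E :=
    ⟨Function.support (planeWave L a f N), (planeWave L a f N).continuous.isOpen_support⟩
  have hOΩ (a : PeriodicProfile) : O a ≤ Ω :=
    subset_closure.trans (planeWave L a f N).tsupport_subset
  have hval {a : PeriodicProfile} {c : ℝ} (ha : ∀ s, a s ≠ 0 → h s = c) :
      ∀ x ∈ O a, planeWave L h χ N x = c := fun x hx => by
    rw [planeWave_apply, ha _ (left_ne_zero_of_mul hx),
      hχf x (subset_tsupport _ (right_ne_zero_of_mul hx)), smul_eq_mul, mul_one]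
  have hdisj : Disjoint (O a₁ : Set E) (O a₂) := Set.disjoint_left.2 fun x hx₁ hx₂ => by
    linarith [hval hval₁ x hx₁, hval hval₂ x hx₂]
  have hsum : ν.real (O a₁) + ν.real (O a₂) ≤ ν.real Ω := by
    rw [← measureReal_union hdisj (O a₂).isOpen.measurableSet
      (measure_ne_top_of_subset (hOΩ a₁) hΩ) (measure_ne_top_of_subset (hOΩ a₂) hΩ)]
    exact measureReal_mono (Set.union_subset (hOΩ a₁) (hOΩ a₂)) hΩ
  exact ⟨O a₁, O a₂, hOΩ a₁, hOΩ a₂, hdisj, hval hval₁, hval hval₂,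
    abs_sub_mul_lt_of_add_le hμ hN₁ hN₂ hsum⟩

end Cutoff

theorem add_smul_sub_mem_segment {V : Type*} [AddCommGroup V] [Module ℝ V] {a b t : ℝ}
    (hab : a + b = 1) (ht : t ∈ Set.Icc (-b) a) (x y : V) :
    a • x + b • y + t • (y - x) ∈ segment ℝ x y :=
  ⟨a - t, b + t, sub_nonneg.2 ht.2, by linarith [ht.1], by linarith, by module⟩

theorem eventually_forall_norm_lt {ι α F : Type*} [SeminormedAddCommGroup F] {l : Filter ι}
    {f : ι × α → F} (hf : Tendsto f (l ×ˢ ⊤) (𝓝 0)) {ε : ℝ} (hε : 0 < ε) :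
    ∀ᶠ i in l, ∀ x, ‖f (i, x)‖ < ε := by
  have hnorm := hf.norm.eventually (gt_mem_nhds (norm_zero.trans_lt hε))
  rw [← principal_univ, eventually_prod_principal_iff] at hnorm
  simpa only [Set.mem_univ, forall_const] using hnorm

theorem setIntegral_testFunction {E F : Type*} [NormedAddCommGroup E] [NormedSpace ℝ E]
    [NormedAddCommGroup F] [NormedSpace ℝ F] [MeasurableSpace E] (ν : Measure E) {Ω : Opens E}
    (φ : 𝓓(Ω, F)) : ∫ x in Ω, φ x ∂ν = ∫ x, φ x ∂ν :=
  setIntegral_eq_integral_of_forall_compl_eq_zero fun _ hx =>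
    image_eq_zero_of_notMem_tsupport fun h => hx (φ.tsupport_subset h)

theorem lemma2p6 (n : ℕ) (B : Matrix (Fin n) (Fin n) ℝ)
    (w w₁ w₂ : State n) (μ₁ μ₂ : ℝ) (hμ₁ : 0 ≤ μ₁) (hμ₂ : 0 ≤ μ₂) (hμ : μ₁ + μ₂ = 1)
    (hw : w = μ₁ • w₁ + μ₂ • w₂) (hcone : w₂ - w₁ ∈ waveCone n)
    (O : Set (EuclideanSpace ℝ (Fin n))) (hO : IsOpen O) (hOfin : volume O < ⊤)
    (ε : ℝ) (hε : 0 < ε) :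
    ∃ w' : EuclideanSpace ℝ (Fin n) → State n,
      ContDiff ℝ ∞ w' ∧ HasCompactSupport w' ∧ tsupport w' ⊆ O ∧
      (∫ x in O, w' x) = 0 ∧
      (∀ x, divVec (fun y => (w' y).vec) x = 0) ∧
      (∀ x, divMat (fun y => (w' y).mat) x - B *ᵥ (w' x).vec.ofLp = 0) ∧
      (∀ x ∈ O, Metric.infDist (w + w' x) (segment ℝ w₁ w₂) < ε) ∧
      ∃ O₁ O₂ : Set (EuclideanSpace ℝ (Fin n)),
        IsOpen O₁ ∧ IsOpen O₂ ∧ O₁ ⊆ O ∧ O₂ ⊆ O ∧ Disjoint O₁ O₂ ∧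
        (∀ x ∈ O₁, ‖w + w' x - w₁‖ < ε) ∧ (∀ x ∈ O₂, ‖w + w' x - w₂‖ < ε) ∧
        |volume.real O₁ - μ₁ * volume.real O| < ε ∧
        |volume.real O₂ - μ₂ * volume.real O| < ε := by
  let Ω : Opens (EuclideanSpace ℝ (Fin n)) := ⟨O, hO⟩
  obtain ⟨L, hL, hfield⟩ := exists_tendsto_field_sub_planeWave_smul B hcone Ω
  obtain ⟨h, χ, hmean, hrange, hplateau⟩ :=
    exists_planeWave_twoPlateau volume (Ω := Ω) hOfin.ne hL hμ₁ hμ₂ hμ hε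
  obtain ⟨P, φ, hlim⟩ := hfield h hmean χ
  obtain ⟨N, ⟨O₁, O₂, hO₁, hO₂, hdisj, hval₁, hval₂, hvol₁, hvol₂⟩, hN⟩ :=
    (hplateau.and (eventually_forall_norm_lt hlim hε)).exists
  set w' := P.field (φ N)
  have hnear (x) : ‖w + w' x - (w + planeWave L h χ N x • (w₂ - w₁))‖ < ε := by
    simpa only [add_sub_add_left_eq_sub] using hN x
  have hw₁ : w + -μ₂ • (w₂ - w₁) = w₁ := by rw [hw, eq_sub_of_add_eq hμ]; module
  have hw₂ : w + μ₁ • (w₂ - w₁) = w₂ := by rw [hw, eq_sub_of_add_eq' hμ]; module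
  refine ⟨w', w'.contDiff, w'.hasCompactSupport, w'.tsupport_subset,
    (setIntegral_testFunction volume w').trans (P.integral_field _), P.divVec_field _,
    fun x => sub_eq_zero.2 (P.divMat_field _ x), fun x _ => ?_, O₁, O₂, O₁.isOpen, O₂.isOpen,
    hO₁, hO₂, hdisj, fun x hx => ?_, fun x hx => ?_, hvol₁, hvol₂⟩
  · have hmem := hw ▸ add_smul_sub_mem_segment hμ (hrange N x) w₁ w₂
    exact (Metric.infDist_le_dist_of_mem hmem).trans_lt ((dist_eq_norm _ _).trans_lt (hnear x))
  · simpa only [hval₁ x hx, hw₁] using hnear x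
  · simpa only [hval₂ x hx, hw₂] using hnear x
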